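/- Let $R$ be a Cohen--Macaulay (Noetherian) local ring and let $I\subseteq R$ be an ideal of height $k\ge 2$ such that $\overline R:=R/I$ is a Cohen--Macaulay local ring. Assume that $R$ is Gorenstein, that is, of finite injective dimension over itself. Let $M$ be a finitely generated $R$-module and let $$0\to IF\xrightarrow{\ \iota\ } M\xrightarrow{\ \rho\ } W\to 0$$ be a short exact sequence of $R$-modules where $F$ is a free $R$-module and $IW=0$ (an $I$-free approximation of $M$); consider $W$ as an $\overline R$-module, and assume that $W\ne 0$. Denote by $\operatorname{Gdim}(M)$ the Gorenstein dimension of the $R$-module $M$, that is, the least length $d$ of an exact sequence $0\to G_d\to\dots\to G_0\to M\to 0$ in which each $G_j$ is finitely generated and reflexive with $\operatorname{Ext}^i_R(G_j,R)=0=\operatorname{Ext}^i_R(\operatorname{Hom}_R(G_j,R),R)$ for all $i>0$ (and $\infty$ if there is no such sequence). Then: 1. $W$ is a maximal Cohen--Macaulay $\overline R$-module if and only if $\operatorname{Gdim}(M)\le k$. 2. If $W$ is a maximal Cohen--Macaulay $\overline R$-module, then $\operatorname{Gdim}(M)\le k-1$ if and only if $\operatorname{Ext}^k_R(M,R)=0$.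 3. Let $\omega_R$ be a canonical module of $R$ (a maximal Cohen--Macaulay module of type $1$ and of finite injective dimension), let $V$ be the quotient of $\operatorname{Hom}_R(F,\omega_R)$ by the submodule of all $\varphi$ for which $\varphi|_{IF}\colon IF\to I\omega_R$ is of the form $\psi\circ\iota$ with $\psi\in\operatorname{Hom}_R(M,I\omega_R)$, let $\alpha\colon\operatorname{Hom}_R(F,\omega_R)\to V$ be the canonical projection, and let $\overline\alpha:=\overline R\otimes_R\alpha$. If $\overline R$ is Gorenstein and $\overline\alpha$ is not injective, then $\operatorname{Gdim}(M)\ge k-1$. -/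

import Mathlib

open CategoryTheory

universe u

noncomputable section

namespace ResidualDuality

/-! ### Depth, Cohen-Macaulay and Gorenstein local rings, canonical modules -/

section LocalRings

variable (A : Type u) [CommRing A] [IsLocalRing A]

/-- The depth of a module over a local ring: the supremum of the lengths of the sequences of
elements of the maximal ideal in which each element is a nonzerodivisor on the quotient of the
module by the preceding ones. The zero module has depth `⊤`. -/
def depth (N : Type u) [AddCommGroup N] [Module A N] : ℕ∞ :=
  ⨆ (rs : List A) (_ : ∀ r ∈ rs, r ∈ IsLocalRing.maximalIdeal A)
    (_ : RingTheory.Sequence.IsWeaklyRegular N rs), (rs.length : ℕ∞)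

/-- A Cohen-Macaulay local ring: a Noetherian local ring whose depth is its Krull dimension. -/
structure IsCohenMacaulayLocalRing : Prop where
  isNoetherianRing : IsNoetherianRing A
  depth_eq : (depth A A : WithBot ℕ∞) = ringKrullDim A

/-- A Gorenstein local ring: a Noetherian local ring of finite injective dimension over itself. -/
structure IsGorensteinLocalRing : Prop where
  isNoetherianRing : IsNoetherianRing A
  exists_injectiveDimensionLE : ∃ d : ℕ, HasInjectiveDimensionLE (ModuleCat.of A A) d

/-- A maximal Cohen-Macaulay module: a finitely generated module whose depth equals its dimension
(the dimension of its support) and whose dimension is that of the ring. -/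
structure IsMaximalCohenMacaulay (N : Type u) [AddCommGroup N] [Module A N] : Prop where
  finite : Module.Finite A N
  depth_eq : (depth A N : WithBot ℕ∞) = Module.supportDim A N
  supportDim_eq : Module.supportDim A N = ringKrullDim A

/-- The type `dim_κ Ext^t(κ, N)`, where `κ` is the residue field and `t` the depth of `N`. (The
length over `A` is the dimension over `κ`, since the maximal ideal annihilates this module.) -/
def cohenMacaulayType (N : Type u) [AddCommGroup N] [Module A N] : ℕ∞ :=
  Module.length A (Abelian.Ext (ModuleCat.of A (IsLocalRing.ResidueField A)) (ModuleCat.of A N)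
    (depth A N).toNat)

/-- A canonical module of a Cohen-Macaulay local ring: a maximal Cohen-Macaulay module of type `1`
and of finite injective dimension. -/
structure IsCanonicalModule (N : Type u) [AddCommGroup N] [Module A N] : Prop where
  isMaximalCohenMacaulay : IsMaximalCohenMacaulay A N
  type_eq_one : cohenMacaulayType A N = 1
  exists_injectiveDimensionLE : ∃ d : ℕ, HasInjectiveDimensionLE (ModuleCat.of A N) d

end LocalRings

/-! ### Gorenstein dimension -/

section GorensteinDimension

variable (A : Type u) [CommRing A]

/-- Modules of Gorenstein dimension zero (totally reflexive modules): finitely generated reflexive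
modules `G` such that `Ext^i(G, A) = 0` and `Ext^i(G^*, A) = 0` for all `i > 0`. -/
structure IsTotallyReflexive (G : Type u) [AddCommGroup G] [Module A G] : Prop where
  finite : Module.Finite A G
  isReflexive : Module.IsReflexive A G
  ext_eq_zero : ∀ i : ℕ, 0 < i →
    Subsingleton (Abelian.Ext (ModuleCat.of A G) (ModuleCat.of A A) i)
  ext_dual_eq_zero : ∀ i : ℕ, 0 < i →
    Subsingleton (Abelian.Ext (ModuleCat.of A (Module.Dual A G)) (ModuleCat.of A A) i)

/-- `HasGorensteinDimLE A d N` : there is an exact sequence `0 → G_d → ⋯ → G_0 → N → 0` in which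
every `G_i` is totally reflexive. It is spliced from short exact sequences. -/
def HasGorensteinDimLE : ℕ → ModuleCat.{u} A → Prop
  | 0, N => IsTotallyReflexive A N
  | d + 1, N => ∃ (K G : ModuleCat.{u} A) (f : K →ₗ[A] G) (g : G →ₗ[A] N),
      Function.Injective f ∧ Function.Exact f g ∧ Function.Surjective g ∧
        IsTotallyReflexive A G ∧ HasGorensteinDimLE d K

/-- The Gorenstein dimension: the least length of a resolution by totally reflexive modules, and
`⊤` if there is none. -/
def gorensteinDim (N : Type u) [AddCommGroup N] [Module A N] : ℕ∞ :=
  ⨅ (d : ℕ) (_ : HasGorensteinDimLE A d (ModuleCat.of A N)), (d : ℕ∞)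

end GorensteinDimension

/-! ### Free approximations and their duals -/

section FreeApproximation

variable {R : Type u} [CommRing R] (I : Ideal R)

/-- A short exact sequence `0 → IF → M → W → 0`. It is an `I`-free approximation of `M` when `M`
is finitely generated, `F` is free, and `W` is an `R ⧸ I`-module. -/
structure IFreeApproximation (F M W : Type u) [AddCommGroup F] [Module R F]
    [AddCommGroup M] [Module R M] [AddCommGroup W] [Module R W] where
  ι : (I • ⊤ : Submodule R F) →ₗ[R] M
  ρ : M →ₗ[R] W
  injective_ι : Function.Injective ι
  exact : Function.Exact ι ρ
  surjective_ρ : Function.Surjective ρ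

/-- A linear map `F → E` restricts to a linear map `IF → IE`. -/
def restrictHom (F E : Type u) [AddCommGroup F] [Module R F] [AddCommGroup E] [Module R E] :
    (F →ₗ[R] E) →ₗ[R] ((I • ⊤ : Submodule R F) →ₗ[R] (I • ⊤ : Submodule R E)) where
  toFun φ := φ.restrict fun x hx =>
    (Submodule.map_le_iff_le_comap.mp (by
      rw [Submodule.map_smul'']
      exact Submodule.smul_mono le_rfl le_top) :
        (I • ⊤ : Submodule R F) ≤ (I • ⊤ : Submodule R E).comap φ) hx
  map_add' _ _ := rfl
  map_smul' _ _ := rfl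

namespace IFreeApproximation

variable {I} {F M W : Type u} [AddCommGroup F] [Module R F] [AddCommGroup M] [Module R M]
  [AddCommGroup W] [Module R W] (s : IFreeApproximation I F M W)
  (ω : Type u) [AddCommGroup ω] [Module R ω]

/-- The image of `λ : Hom(M, Iω) → Hom(F, ω)`, where `λ ψ` is characterized by
`(λ ψ)|_{IF} = ψ ∘ ι`. -/
def rangeLambda : Submodule R (F →ₗ[R] ω) :=
  (LinearMap.range (LinearMap.lcomp R (I • ⊤ : Submodule R ω) s.ι)).comap (restrictHom I F ω)

/-- The module `V`, the cokernel of `λ`. -/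
abbrev V : Type u := (F →ₗ[R] ω) ⧸ s.rangeLambda ω

/-- The projection `α : Hom(F, ω) → V`. -/
def alpha : (F →ₗ[R] ω) →ₗ[R] s.V ω := (s.rangeLambda ω).mkQ

/-- The map `R ⧸ I ⊗ α : R ⧸ I ⊗ Hom(F, ω) → R ⧸ I ⊗ V`, where `R ⧸ I ⊗ Hom(F, ω)` is
`Hom(F, R ⧸ I ⊗ ω)` and `R ⧸ I ⊗ V` is `V`. -/
def alphaBar : TensorProduct R (R ⧸ I) (F →ₗ[R] ω) →ₗ[R] TensorProduct R (R ⧸ I) (s.V ω) :=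
  (s.alpha ω).lTensor (R ⧸ I)

end IFreeApproximation

end FreeApproximation

end ResidualDuality

end

/-!
Everything is read off from the vanishing of the modules `Ext^i(-, R)`, where `R` is Gorenstein of
depth and dimension `n`. Two criteria carry the proof.

* A finitely generated module `M` has Gorenstein dimension at most `d` if and only if
  `Ext^i(M, R) = 0` for all `i > d` (`gorensteinDim_le_iff`). For `d = 0`, dualizing the syzygy
  sequences of `M` shifts `Ext^i(M^*, R)` up to degrees beyond the injective dimension of `R`, and
  comparing a free cover of `M` with its bidual gives reflexivity.
* A finitely generated module `N` has depth at least `t` if and only if `Ext^i(N, R) = 0` for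
  all `i > n - t` (`hasRegularSequence_iff_extVanishes`). This is an induction on `t` with
  Nakayama's lemma. It needs that `Ext^i(-, R)` vanishes for `i > n` on finitely generated modules,
  and that `Ext^n(κ, R) ≠ 0` for the residue field `κ`, which is Rees' theorem.

Since `dim R / I = n - k` (`exists_ringKrullDim_quotient_eq`), the module `W` is maximal
Cohen-Macaulay if and only if `Ext^i(W, R) = 0` for `i > k`. The same holds for `R / I`, so that
`Ext^i(IF, R) = 0` for `i ≥ k`. The long exact sequence of the approximation then identifies the
vanishing of `Ext^i(W, R)` with that of `Ext^i(M, R)` for `i > k`, which gives the first two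
assertions.

For the third one, a canonical module `ω` is isomorphic to `R`: it is totally reflexive and of
finite injective dimension, so its embedding into a projective module with totally reflexive
cokernel splits, and its type is a multiple of its rank. If `R / I ⊗ α` is not injective, some
`φ : F → R` outside `I Hom(F, R)` restricts on `IF` to a map that extends to `M → I`. For a value
`r ∉ I` of `φ`, multiplication by `r` on `I` factors through `M`. If `Gdim M ≤ k - 2`, then
`Ext^{k-1}(M, R) = 0`, so `r` annihilates `Ext^{k-1}(I, R) ≅ Ext^k(R / I, R)`. But this module is
faithful over `R / I` (`smul_eq_zero_of_killsExt`): passing to quotients by powers of regular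
elements reduces the claim to modules of finite length, on which `Ext^n(-, R)` is exact and
faithful.
-/

noncomputable section

namespace ResidualDuality

open Abelian IsLocalRing RingTheory.Sequence
open scoped Pointwise TensorProduct

/-! ### Vanishing of `Ext` along short exact sequences -/

section ExtSequences

variable {R : Type u} [CommRing R] {A B C : Type u} [AddCommGroup A] [Module R A]
  [AddCommGroup B] [Module R B] [AddCommGroup C] [Module R C]
  (Y : Type u) [AddCommGroup Y] [Module R Y]

/-- The vanishing `Ext^i(N, Y) = 0`, for unbundled modules. -/
abbrev ExtVanishes (R : Type u) [CommRing R] (N Y : Type u) [AddCommGroup N] [Module R N]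
    [AddCommGroup Y] [Module R Y] (i : ℕ) : Prop :=
  Subsingleton (Ext (ModuleCat.of R N) (ModuleCat.of R Y) i)

/-- A short exact sequence of modules, as a short complex. -/
abbrev shortComplexOfExact (f : A →ₗ[R] B) (g : B →ₗ[R] C) (h : Function.Exact f g) :
    ShortComplex (ModuleCat.{u} R) :=
  ModuleCat.shortComplexOfCompEqZero f g h.linearMap_comp_eq_zero

variable {f : A →ₗ[R] B} {g : B →ₗ[R] C}

lemma shortExact_shortComplexOfExact (hf : Function.Injective f) (h : Function.Exact f g)
    (hg : Function.Surjective g) : (shortComplexOfExact f g h).ShortExact where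
  exact := ModuleCat.shortComplex_exact _ h
  mono_f := (ModuleCat.mono_iff_injective _).mpr hf
  epi_g := (ModuleCat.epi_iff_surjective _).mpr hg

variable {Y}

lemma ExtVanishes.middle (hf : Function.Injective f) (h : Function.Exact f g)
    (hg : Function.Surjective g) {i : ℕ} (hA : ExtVanishes R A Y i) (hC : ExtVanishes R C Y i) :
    ExtVanishes R B Y i := by
  refine subsingleton_of_forall_eq 0 fun x => ?_
  obtain ⟨y, rfl⟩ := Ext.contravariant_sequence_exact₂
    (shortExact_shortComplexOfExact hf h hg) (ModuleCat.of R Y) x (hA.elim _ _)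
  rw [hC.elim y 0, Ext.comp_zero]

lemma ExtVanishes.left (hf : Function.Injective f) (h : Function.Exact f g)
    (hg : Function.Surjective g) {i : ℕ} (hB : ExtVanishes R B Y i)
    (hC : ExtVanishes R C Y (i + 1)) : ExtVanishes R A Y i := by
  refine subsingleton_of_forall_eq 0 fun x => ?_
  obtain ⟨y, rfl⟩ := Ext.contravariant_sequence_exact₁
    (shortExact_shortComplexOfExact hf h hg) (ModuleCat.of R Y) x (add_comm 1 i) (hC.elim _ _)
  rw [hB.elim y 0, Ext.comp_zero]

lemma ExtVanishes.right (hf : Function.Injective f) (h : Function.Exact f g)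
    (hg : Function.Surjective g) {i : ℕ} (hA : ExtVanishes R A Y i)
    (hB : ExtVanishes R B Y (i + 1)) : ExtVanishes R C Y (i + 1) := by
  refine subsingleton_of_forall_eq 0 fun x => ?_
  obtain ⟨y, rfl⟩ := Ext.contravariant_sequence_exact₃
    (shortExact_shortComplexOfExact hf h hg) (ModuleCat.of R Y) x (hB.elim _ _) (add_comm 1 i)
  rw [hA.elim y 0, Ext.comp_zero]

lemma ExtVanishes.of_equiv (e : A ≃ₗ[R] B) {i : ℕ} (hA : ExtVanishes R A Y i) :
    ExtVanishes R B Y i := by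
  refine subsingleton_of_forall_eq 0 fun x => ?_
  have : x = (Ext.mk₀ (ModuleCat.ofHom (e.symm : B →ₗ[R] A))).comp
      ((Ext.mk₀ (ModuleCat.ofHom (e : A →ₗ[R] B))).comp x (zero_add i)) (zero_add i) := by
    rw [Ext.mk₀_comp_mk₀_assoc, ← ModuleCat.ofHom_comp]
    simp
  rw [this, hA.elim ((Ext.mk₀ (ModuleCat.ofHom (e : A →ₗ[R] B))).comp x (zero_add i)) 0,
    Ext.comp_zero]

lemma ExtVanishes.of_projective [Module.Projective R A] {i : ℕ} (hi : 0 < i) :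
    ExtVanishes R A Y i := by
  obtain ⟨j, rfl⟩ := Nat.exists_eq_succ_of_ne_zero hi.ne'
  have : Projective (ModuleCat.of R A) :=
    (IsProjective.iff_projective A).mp inferInstance
  exact subsingleton_of_forall_eq 0 fun x => Ext.eq_zero_of_projective x

lemma ExtVanishes.of_subsingleton [Subsingleton A] (i : ℕ) : ExtVanishes R A Y i := by
  refine subsingleton_of_forall_eq 0 fun x => ?_
  have : x = (Ext.mk₀ (𝟙 (ModuleCat.of R A))).comp x (zero_add i) := by simp
  rw [this]
  have h0 : 𝟙 (ModuleCat.of R A) = 0 := by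
    ext a
    exact Subsingleton.elim _ _
  rw [h0, Ext.mk₀_zero, Ext.zero_comp]

lemma extVanishes_zero_iff : ExtVanishes R A Y 0 ↔ Subsingleton (A →ₗ[R] Y) :=
  (Ext.addEquiv₀.trans ModuleCat.homAddEquiv).subsingleton_congr

/-- Linear maps extend along an injection with cokernel `C` when `Ext^1(C, Y) = 0`. -/
lemma ExtVanishes.exists_extension (hf : Function.Injective f) (h : Function.Exact f g)
    (hg : Function.Surjective g) (hC : ExtVanishes R C Y 1) (φ : A →ₗ[R] Y) :
    ∃ ψ : B →ₗ[R] Y, ψ ∘ₗ f = φ := by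
  obtain ⟨y, hy⟩ := Ext.contravariant_sequence_exact₁
    (shortExact_shortComplexOfExact hf h hg) (ModuleCat.of R Y)
    (Ext.mk₀ (ModuleCat.ofHom φ)) (add_comm 1 0) (hC.elim _ _)
  obtain ⟨ψ, rfl⟩ := (Ext.mk₀_bijective _ _).2 y
  erw [Ext.mk₀_comp_mk₀] at hy
  have := (Ext.mk₀_bijective _ _).1 hy
  exact ⟨ψ.hom, by simpa using congrArg ModuleCat.Hom.hom this⟩

end ExtSequences

/-! ### Scalars acting on `Ext` -/

section ExtScalars

variable {R : Type u} [CommRing R] {A B C Y : Type u} [AddCommGroup A] [Module R A]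
  [AddCommGroup B] [Module R B] [AddCommGroup C] [Module R C] [AddCommGroup Y] [Module R Y]
  {f : A →ₗ[R] B} {g : B →ₗ[R] C}

/-- The element `r` annihilates `Ext^i(N, Y)`. -/
abbrev KillsExt (r : R) (N Y : Type u) [AddCommGroup N] [Module R N]
    [AddCommGroup Y] [Module R Y] (i : ℕ) : Prop :=
  ∀ x : Ext (ModuleCat.of R N) (ModuleCat.of R Y) i, r • x = 0

lemma smul_ext_eq_of_comp_eq_smul {r : R} {f : A →ₗ[R] B} {g : B →ₗ[R] A}
    (hr : ∀ a, g (f a) = r • a) {i : ℕ} (x : Ext (ModuleCat.of R A) (ModuleCat.of R Y) i) :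
    (Ext.mk₀ (ModuleCat.ofHom f)).comp ((Ext.mk₀ (ModuleCat.ofHom g)).comp x (zero_add i))
      (zero_add i) = r • x := by
  have : ModuleCat.ofHom f ≫ ModuleCat.ofHom g = r • 𝟙 (ModuleCat.of R A) := by
    ext a
    exact hr a
  rw [Ext.mk₀_comp_mk₀_assoc, this, Ext.mk₀_smul, Ext.smul_comp, Ext.mk₀_id_comp]

/-- If multiplication by `r` on `A` factors through `B` and `Ext^i(B, Y) = 0`, then `r`
annihilates `Ext^i(A, Y)`. -/
lemma ExtVanishes.killsExt_of_factors {r : R} {f : A →ₗ[R] B} {g : B →ₗ[R] A}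
    (hr : ∀ a, g (f a) = r • a) {i : ℕ} (hB : ExtVanishes R B Y i) : KillsExt r A Y i := by
  intro x
  rw [← smul_ext_eq_of_comp_eq_smul hr, hB.elim
    ((Ext.mk₀ (ModuleCat.ofHom g)).comp x (zero_add i)) 0, Ext.comp_zero]

lemma KillsExt.right {r : R} (hf : Function.Injective f) (h : Function.Exact f g)
    (hg : Function.Surjective g) {i : ℕ} (hA : KillsExt r A Y i)
    (hB : ExtVanishes R B Y (i + 1)) : KillsExt r C Y (i + 1) := by
  intro x
  obtain ⟨y, rfl⟩ := Ext.contravariant_sequence_exact₃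
    (shortExact_shortComplexOfExact hf h hg) (ModuleCat.of R Y) x (hB.elim _ _) (add_comm 1 i)
  rw [← Ext.comp_smul]
  have hy : r • y = 0 := hA y
  rw [hy, Ext.comp_zero]

/-- Nakayama's lemma turns vanishing of `Ext^{i+1}(A/xA, Y)` into vanishing of `Ext^i(A, Y)`. -/
lemma ExtVanishes.of_quotSMulTop [IsLocalRing R] [IsNoetherianRing R] [Module.Finite R A]
    [Module.Finite R Y] {x : R} (hx : x ∈ IsLocalRing.maximalIdeal R) (hreg : IsSMulRegular A x)
    {i : ℕ} (h : ExtVanishes R (QuotSMulTop x A) Y (i + 1)) : ExtVanishes R A Y i := by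
  have key : ∀ e : Ext (ModuleCat.of R A) (ModuleCat.of R Y) i, ∃ e', x • e' = e := by
    intro e
    obtain ⟨y, hy⟩ := Ext.contravariant_sequence_exact₁
      (shortExact_shortComplexOfExact (f := LinearMap.lsmul R A x) hreg
        (LinearMap.exact_lsmul_mkQ_smul_top A x)
        (Submodule.mkQ_surjective _)) (ModuleCat.of R Y) e (add_comm 1 i) (h.elim _ _)
    refine ⟨y, ?_⟩
    rw [← hy]
    have : (shortComplexOfExact _ _ (LinearMap.exact_lsmul_mkQ_smul_top A x)).f =
      x • 𝟙 (ModuleCat.of R A) := rfl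
    rw [this, Ext.mk₀_smul, Ext.smul_comp]
    exact (congrArg _ (Ext.mk₀_id_comp _)).symm
  have htop : (⊤ : Submodule R (Ext (ModuleCat.of R A) (ModuleCat.of R Y) i)) ≤
      IsLocalRing.maximalIdeal R • ⊤ := by
    intro e _
    obtain ⟨e', rfl⟩ := key e
    exact Submodule.smul_mem_smul hx trivial
  have hbot := Submodule.eq_bot_of_le_smul_of_le_jacobson_bot _ _
    (Module.Finite.fg_top (R := R)
      (M := Ext (ModuleCat.of R A) (ModuleCat.of R Y) i)) htop
    (IsLocalRing.maximalIdeal_le_jacobson _)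
  exact (Submodule.subsingleton_iff R).mp (subsingleton_of_bot_eq_top hbot.symm)

lemma ExtVanishes.quotSMulTop {x : R} (hreg : IsSMulRegular A x)
    {i : ℕ} (h : ExtVanishes R A Y i) (h' : ExtVanishes R A Y (i + 1)) :
    ExtVanishes R (QuotSMulTop x A) Y (i + 1) :=
  ExtVanishes.right (f := LinearMap.lsmul R A x) hreg (LinearMap.exact_lsmul_mkQ_smul_top A x)
    (Submodule.mkQ_surjective _) h h'

end ExtScalars

/-! ### Totally reflexive modules and Gorenstein dimension -/

section TotallyReflexive

variable {R : Type u} [CommRing R]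

/-- `R` has finite injective dimension as a module over itself. -/
abbrev HasFiniteSelfInjectiveDimension (R : Type u) [CommRing R] : Prop :=
  ∃ d : ℕ, HasInjectiveDimensionLE (ModuleCat.of R R) d

lemma exists_extVanishes_of_injectiveDimensionLE {Y : Type u} [AddCommGroup Y] [Module R Y]
    (h : ∃ d : ℕ, HasInjectiveDimensionLE (ModuleCat.of R Y) d) :
    ∃ d : ℕ, ∀ i, d < i → ∀ (N : Type u) [AddCommGroup N] [Module R N], ExtVanishes R N Y i := by
  obtain ⟨d, hd⟩ := h
  refine ⟨d, fun i hi N _ _ => subsingleton_of_forall_eq 0 fun x => ?_⟩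
  exact Ext.eq_zero_of_hasInjectiveDimensionLT (X := ModuleCat.of R Y) x (d + 1) hi

variable {K P M : Type u} [AddCommGroup K] [Module R K] [AddCommGroup P] [Module R P]
  [AddCommGroup M] [Module R M]

lemma exists_finite_free_cover (R : Type u) [CommRing R] [IsNoetherianRing R]
    (M : Type u) [AddCommGroup M] [Module R M] [Module.Finite R M] :
    ∃ (n : ℕ) (K : Type u) (_ : AddCommGroup K) (_ : Module R K) (_ : Module.Finite R K)
      (f : K →ₗ[R] (Fin n → R)) (g : (Fin n → R) →ₗ[R] M),
      Function.Injective f ∧ Function.Exact f g ∧ Function.Surjective g := by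
  obtain ⟨n, g, hg⟩ := Module.Finite.exists_fin' R M
  exact ⟨n, LinearMap.ker g, inferInstance, inferInstance, inferInstance,
    (LinearMap.ker g).subtype, g, Subtype.val_injective, LinearMap.exact_subtype_ker_map g, hg⟩

/-- Dualizing a short exact sequence `0 → K → P → M → 0` with `Ext^1(M, R) = 0` gives a short
exact sequence `0 → M^* → P^* → K^* → 0`. -/
lemma dual_shortExact {f : K →ₗ[R] P} {g : P →ₗ[R] M} (hf : Function.Injective f)
    (h : Function.Exact f g) (hg : Function.Surjective g) (hM : ExtVanishes R M R 1) :
    Function.Injective g.dualMap ∧ Function.Exact g.dualMap f.dualMap ∧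
      Function.Surjective f.dualMap := by
  refine ⟨LinearMap.dualMap_injective_of_surjective hg, ?_, fun φ => ?_⟩
  · exact LinearMap.exact_lcomp_of_exact_of_surjective R h hg
  · exact hM.exists_extension hf h hg φ

lemma extVanishes_of_hasGorensteinDimLE {d : ℕ} {N : ModuleCat.{u} R}
    (h : HasGorensteinDimLE R d N) {i : ℕ} (hi : d < i) : ExtVanishes R N R i := by
  induction d generalizing N i with
  | zero => exact h.ext_eq_zero i hi
  | succ d ih =>
    obtain ⟨K, G, f, g, hf, hfg, hg, hG, hK⟩ := h
    obtain ⟨j, rfl⟩ := Nat.exists_eq_succ_of_ne_zero (n := i) (by omega)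
    exact ExtVanishes.right hf hfg hg (ih hK (by omega)) (hG.ext_eq_zero _ (by omega))

variable [IsNoetherianRing R]

lemma extVanishes_dual (hR : HasFiniteSelfInjectiveDimension R) [Module.Finite R M]
    (hM : ∀ i, 0 < i → ExtVanishes R M R i) (i : ℕ) (hi : 0 < i) :
    ExtVanishes R (Module.Dual R M) R i := by
  obtain ⟨d, hd⟩ := exists_extVanishes_of_injectiveDimensionLE hR
  -- descending induction on `i`, starting above the injective dimension
  suffices H : ∀ (c i : ℕ), 0 < i → d < i + c → ∀ (M : Type u) [AddCommGroup M] [Module R M]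
      [Module.Finite R M], (∀ i, 0 < i → ExtVanishes R M R i) →
      ExtVanishes R (Module.Dual R M) R i from H (d + 1) i hi (by omega) M hM
  intro c
  induction c with
  | zero => exact fun i _ hi' M _ _ _ _ => hd i (by omega) _
  | succ c ih =>
    intro i hi hi' M _ _ _ hM
    obtain ⟨n, K, _, _, _, f, g, hf, h, hg⟩ := exists_finite_free_cover R M
    obtain ⟨hf', h', hg'⟩ := dual_shortExact hf h hg (hM 1 one_pos)
    exact ExtVanishes.left hf' h' hg' (.of_projective hi)
      (ih (i + 1) (by omega) (by omega) K fun j hj =>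
        ExtVanishes.left hf h hg (.of_projective hj) (hM (j + 1) (by omega)))

lemma surjective_dualEval (hR : HasFiniteSelfInjectiveDimension R) [Module.Finite R M]
    (hM : ∀ i, 0 < i → ExtVanishes R M R i) : Function.Surjective (Module.Dual.eval R M) := by
  intro φ
  obtain ⟨n, K, _, _, _, f, g, hf, h, hg⟩ := exists_finite_free_cover R M
  obtain ⟨hf', h', hg'⟩ := dual_shortExact hf h hg (hM 1 one_pos)
  have hK : ∀ i, 0 < i → ExtVanishes R K R i := fun j hj =>
    ExtVanishes.left hf h hg (.of_projective hj) (hM (j + 1) (by omega))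
  obtain ⟨ψ, rfl⟩ := (extVanishes_dual hR hK 1 one_pos).exists_extension hf' h' hg' φ
  obtain ⟨p, rfl⟩ := (Module.bijective_dual_eval R (Fin n → R)).2 ψ
  exact ⟨g p, rfl⟩

/-- Over a Noetherian ring of finite self-injective dimension, a finitely generated module `M`
with `Ext^i(M, R) = 0` for all `i > 0` is totally reflexive. -/
lemma isTotallyReflexive_of_extVanishes (hR : HasFiniteSelfInjectiveDimension R)
    [Module.Finite R M] (hM : ∀ i, 0 < i → ExtVanishes R M R i) : IsTotallyReflexive R M where
  finite := inferInstance
  ext_eq_zero := hM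
  ext_dual_eq_zero := extVanishes_dual hR hM
  isReflexive := by
    refine ⟨(injective_iff_map_eq_zero _).mpr fun m hm => ?_, surjective_dualEval hR hM⟩
    obtain ⟨n, K, _, _, _, f, g, hf, h, hg⟩ := exists_finite_free_cover R M
    obtain ⟨hf', h', hg'⟩ := dual_shortExact hf h hg (hM 1 one_pos)
    obtain ⟨p, rfl⟩ := hg m
    -- evaluation at `p` factors through `f.dualMap`, hence is evaluation at an element of `K`
    have hker : LinearMap.ker f.dualMap ≤ LinearMap.ker (Module.Dual.eval R (Fin n → R) p) := by
      intro ψ hψ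
      obtain ⟨μ, rfl⟩ := (h' ψ).mp hψ
      exact LinearMap.congr_fun hm μ
    let χ : Module.Dual R (Module.Dual R K) :=
      (LinearMap.ker f.dualMap).liftQ _ hker ∘ₗ
        (f.dualMap.quotKerEquivOfSurjective hg').symm.toLinearMap
    obtain ⟨k, hk⟩ := surjective_dualEval hR (fun j hj =>
      ExtVanishes.left hf h hg (.of_projective hj) (hM (j + 1) (by omega))) χ
    have hpk : p = f k := by
      refine (Module.bijective_dual_eval R (Fin n → R)).1 (LinearMap.ext fun ψ => ?_)
      have h1 : χ (f.dualMap ψ) = ψ p := by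
        have : (f.dualMap.quotKerEquivOfSurjective hg').symm (f.dualMap ψ) =
            Submodule.Quotient.mk ψ := by
          rw [LinearEquiv.symm_apply_eq]
          rfl
        simp only [χ, LinearMap.comp_apply, LinearEquiv.coe_coe, this]
        rfl
      rw [← hk] at h1
      exact h1.symm
    rw [hpk]
    exact (h (f k)).mpr ⟨k, rfl⟩

lemma subsingleton_of_extVanishes (hR : HasFiniteSelfInjectiveDimension R) [Module.Finite R M]
    (h : ∀ i, ExtVanishes R M R i) : Subsingleton M := by
  have := (isTotallyReflexive_of_extVanishes hR fun i _ => h i).isReflexive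
  have := extVanishes_zero_iff.mp (h 0)
  exact (Module.bijective_dual_eval R M).1.subsingleton

lemma hasGorensteinDimLE_of_extVanishes (hR : HasFiniteSelfInjectiveDimension R) {d : ℕ}
    {N : ModuleCat.{u} R} [Module.Finite R N] (h : ∀ i, d < i → ExtVanishes R N R i) :
    HasGorensteinDimLE R d N := by
  induction d generalizing N with
  | zero => exact isTotallyReflexive_of_extVanishes hR h
  | succ d ih =>
    obtain ⟨n, K, _, _, _, f, g, hf, hfg, hg⟩ := exists_finite_free_cover R N
    refine ⟨ModuleCat.of R K, ModuleCat.of R (Fin n → R), f, g, hf, hfg, hg,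
      isTotallyReflexive_of_extVanishes hR fun i hi => .of_projective hi, ih fun i hi => ?_⟩
    exact ExtVanishes.left hf hfg hg (.of_projective (by omega)) (h (i + 1) (by omega))

/-- Over a Noetherian ring of finite self-injective dimension, the Gorenstein dimension of a
finitely generated module is read off from the vanishing of `Ext^i(M, R)`. -/
lemma gorensteinDim_le_iff (hR : HasFiniteSelfInjectiveDimension R) [Module.Finite R M] (d : ℕ) :
    gorensteinDim R M ≤ d ↔ ∀ i, d < i → ExtVanishes R M R i := by
  refine ⟨fun h i hi => ?_, fun h => ?_⟩
  · have hlt : gorensteinDim R M < (i : ℕ∞) := h.trans_lt (by exact_mod_cast hi)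
    simp only [gorensteinDim, iInf_lt_iff] at hlt
    obtain ⟨e, he, hei⟩ := hlt
    exact extVanishes_of_hasGorensteinDimLE he (by exact_mod_cast hei)
  · exact iInf₂_le d (hasGorensteinDimLE_of_extVanishes (N := ModuleCat.of R M) hR h)

end TotallyReflexive

lemma withBot_le_of_add_le_add {a b : WithBot ℕ∞} {m : ℕ} (h : a + m ≤ b + m) : a ≤ b := by
  induction a using WithBot.recBotCoe with
  | bot => exact bot_le
  | coe a =>
    induction b using WithBot.recBotCoe with
    | bot => simp at h
    | coe b =>
      have h' : a + (m : ℕ∞) ≤ b + m := by exact_mod_cast h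
      exact_mod_cast (ENat.add_le_add_iff_right (ENat.natCast_ne_top m)).mp h'

/-! ### Depth and regular sequences -/

section Depth

variable {R : Type u} [CommRing R] [IsLocalRing R]
  {N : Type u} [AddCommGroup N] [Module R N]

/-- There is a weakly regular sequence on `N` of length `t` in the maximal ideal. -/
def HasRegularSequence (R : Type u) [CommRing R] [IsLocalRing R] (N : Type u) [AddCommGroup N]
    [Module R N] (t : ℕ) : Prop :=
  ∃ rs : List R, rs.length = t ∧ (∀ r ∈ rs, r ∈ maximalIdeal R) ∧ IsWeaklyRegular N rs

lemma hasRegularSequence_zero : HasRegularSequence R N 0 := ⟨[], rfl, by simp, .nil R N⟩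

lemma hasRegularSequence_succ_iff {t : ℕ} : HasRegularSequence R N (t + 1) ↔
    ∃ x ∈ maximalIdeal R, IsSMulRegular N x ∧ HasRegularSequence R (QuotSMulTop x N) t := by
  constructor
  · rintro ⟨_ | ⟨x, rs⟩, hl, hm, hr⟩
    · simp at hl
    · rw [isWeaklyRegular_cons_iff] at hr
      exact ⟨x, hm x (by simp), hr.1, rs, by simpa using hl, fun r h => hm r (by simp [h]), hr.2⟩
  · rintro ⟨x, hx, hreg, rs, hl, hm, hr⟩
    exact ⟨x :: rs, by simp [hl], by simpa using ⟨hx, hm⟩, .cons hreg hr⟩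

lemma le_depth_iff {t : ℕ} : (t : ℕ∞) ≤ depth R N ↔ HasRegularSequence R N t := by
  constructor
  · intro h
    rcases Nat.eq_zero_or_pos t with rfl | ht
    · exact hasRegularSequence_zero
    have hlt : ((t - 1 : ℕ) : ℕ∞) < depth R N :=
      lt_of_lt_of_le (by exact_mod_cast Nat.sub_one_lt ht.ne') h
    simp only [depth, lt_iSup_iff] at hlt
    obtain ⟨rs, hm, hr, hl⟩ := hlt
    have hl' : t ≤ rs.length := by
      have : t - 1 < rs.length := by exact_mod_cast hl
      omega
    refine ⟨rs.take t, by simp [hl'], fun r h => hm r (List.mem_of_mem_take h), ?_⟩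
    rw [← List.take_append_drop t rs, isWeaklyRegular_append_iff] at hr
    exact hr.1
  · rintro ⟨rs, rfl, hm, hr⟩
    exact le_iSup_of_le rs (le_iSup_of_le hm (le_iSup_of_le hr le_rfl))

lemma HasRegularSequence.le_supportDim [IsNoetherianRing R] [Module.Finite R N] [Nontrivial N]
    {t : ℕ} (h : HasRegularSequence R N t) : (t : WithBot ℕ∞) ≤ Module.supportDim R N := by
  obtain ⟨rs, rfl, hm, hr⟩ := h
  have hreg := IsRegular.of_isWeaklyRegular_of_mem_maximalIdeal N hm hr
  rw [← Module.supportDim_add_length_eq_supportDim_of_isRegular rs hreg]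
  have : Nontrivial (N ⧸ Ideal.ofList rs • (⊤ : Submodule R N)) :=
    hreg.quot_ofList_smul_nontrivial ⊤
  have hne := Module.supportDim_ne_bot_of_nontrivial R (N ⧸ Ideal.ofList rs • (⊤ : Submodule R N))
  have h0 : (0 : WithBot ℕ∞) ≤
      Module.supportDim R (N ⧸ Ideal.ofList rs • (⊤ : Submodule R N)) := by
    obtain ⟨a, ha⟩ := WithBot.ne_bot_iff_exists.mp hne
    rw [← ha]
    exact_mod_cast zero_le (a := a)
  calc ((rs.length : ℕ) : WithBot ℕ∞) = 0 + rs.length := by simp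
    _ ≤ _ := by gcongr

/-- If no element of the maximal ideal is a nonzerodivisor on `N`, then the residue field embeds
into `N`. -/
lemma exists_residueField_embedding [IsNoetherianRing R] [Module.Finite R N]
    (h : ∀ x ∈ maximalIdeal R, ¬ IsSMulRegular N x) :
    ∃ f : (R ⧸ maximalIdeal R) →ₗ[R] N, Function.Injective f := by
  have hns : ¬ Subsingleton ((R ⧸ maximalIdeal R) →ₗ[R] N) := by
    rw [IsSMulRegular.subsingleton_linearMap_iff]
    rintro ⟨x, hx, hreg⟩
    rw [Ideal.annihilator_quotient] at hx
    exact h x hx hreg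
  rw [not_subsingleton_iff_nontrivial] at hns
  obtain ⟨f, hf⟩ := exists_ne (0 : (R ⧸ maximalIdeal R) →ₗ[R] N)
  have : IsSimpleModule R (R ⧸ maximalIdeal R) :=
    isSimpleModule_iff_isCoatom.mpr (maximalIdeal.isMaximal R).out
  exact ⟨f, (LinearMap.injective_or_eq_zero f).resolve_right hf⟩

omit [IsLocalRing R] in
lemma ExtVanishes.of_injective {A Y : Type u} [AddCommGroup A] [Module R A] [AddCommGroup Y]
    [Module R Y] {f : A →ₗ[R] N} (hf : Function.Injective f) {i : ℕ}
    (hN : ExtVanishes R N Y i) (h : ExtVanishes R (N ⧸ LinearMap.range f) Y (i + 1)) :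
    ExtVanishes R A Y i :=
  .left hf (LinearMap.exact_map_mkQ_range f) (Submodule.mkQ_surjective _) hN h

omit [IsLocalRing R] in
lemma extVanishes_quotient_of_isWeaklyRegular {rs : List R} (hr : IsWeaklyRegular N rs)
    {Y : Type u} [AddCommGroup Y] [Module R Y] {d : ℕ} (h : ∀ i, d < i → ExtVanishes R N Y i)
    (i : ℕ) (hi : d + rs.length < i) :
    ExtVanishes R (N ⧸ Ideal.ofList rs • (⊤ : Submodule R N)) Y i := by
  induction rs generalizing N d with
  | nil =>
    refine ExtVanishes.of_equiv (Submodule.quotEquivOfEqBot _ (by simp)).symm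
      (h i (by simpa using hi))
  | cons x rs ih =>
    rw [isWeaklyRegular_cons_iff] at hr
    simp only [List.length_cons] at hi
    refine ExtVanishes.of_equiv
      (Submodule.quotOfListConsSMulTopEquivQuotSMulTopInner N x rs).symm
      (ih hr.2 (d := d + 1) (fun j hj => ?_) (by omega))
    obtain ⟨j, rfl⟩ := Nat.exists_eq_succ_of_ne_zero (n := j) (by omega)
    exact .quotSMulTop hr.1 (h j (by omega)) (h (j + 1) (by omega))

end Depth

/-! ### Depth and vanishing of `Ext` over a Gorenstein local ring -/

section GorensteinLocal

variable {R : Type u} [CommRing R] [IsLocalRing R] [IsNoetherianRing R]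
  {N : Type u} [AddCommGroup N] [Module R N] [Module.Finite R N]

/-- Vanishing of one `Ext^i(-, Y)` on all finitely generated modules follows from its vanishing
on the residue field if `Ext^{i+1}(-, Y)` vanishes on all finitely generated modules. -/
lemma extVanishes_of_residueField {Y : Type u} [AddCommGroup Y] [Module R Y] [Module.Finite R Y]
    {i : ℕ} (hκ : ExtVanishes R (R ⧸ maximalIdeal R) Y i)
    (h : ∀ (N : Type u) [AddCommGroup N] [Module R N] [Module.Finite R N],
      ExtVanishes R N Y (i + 1)) : ExtVanishes R N Y i := by
  induction ‹Module.Finite R N› using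
    IsNoetherianRing.induction_on_isQuotientEquivQuotientPrime R with
  | subsingleton N => exact .of_subsingleton i
  | exact A B C f g hf hg hfg hA hC => exact .middle hf hfg hg hA hC
  | quotient N p e =>
    refine ExtVanishes.of_equiv e.symm ?_
    by_cases hp : p.1 = maximalIdeal R
    · rw [hp]
      exact hκ
    · obtain ⟨x, hx, hxp⟩ := SetLike.exists_of_lt
        (lt_of_le_of_ne (le_maximalIdeal p.2.ne_top) hp)
      refine ExtVanishes.of_quotSMulTop hx ?_ (h _)
      intro a b hab
      obtain ⟨a, rfl⟩ := Ideal.Quotient.mk_surjective a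
      obtain ⟨b, rfl⟩ := Ideal.Quotient.mk_surjective b
      have hab' : Ideal.Quotient.mk p.1 (x * a) = Ideal.Quotient.mk p.1 (x * b) := hab
      rw [Ideal.Quotient.eq, ← mul_sub] at hab'
      exact Ideal.Quotient.eq.mpr ((p.2.mem_or_mem hab').resolve_left hxp)

variable {n : ℕ} (hR : HasFiniteSelfInjectiveDimension R) (hn : depth R R = n)

include hR hn

/-- The injective dimension of a Gorenstein local ring is at most its depth. -/
lemma extVanishes_of_depth_lt {i : ℕ} (hi : n < i) : ExtVanishes R N R i := by
  obtain ⟨d, hd⟩ := exists_extVanishes_of_injectiveDimensionLE hR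
  suffices H : ∀ (c i : ℕ), n < i → d < i + c → ∀ (N : Type u) [AddCommGroup N] [Module R N]
      [Module.Finite R N], ExtVanishes R N R i from H (d + 1) i hi (by omega) N
  intro c
  induction c with
  | zero => exact fun i _ hi N _ _ _ => hd i (by omega) N
  | succ c ih =>
    intro i hi hc N _ _ _
    refine extVanishes_of_residueField ?_ (ih (i + 1) (by omega) (by omega))
    obtain ⟨rs, hl, hm, hr⟩ := le_depth_iff.mp hn.ge
    -- the residue field embeds into the quotient by a maximal regular sequence
    obtain ⟨f, hf⟩ := exists_residueField_embedding
      (N := R ⧸ Ideal.ofList rs • (⊤ : Submodule R R)) (by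
        intro x hx hreg
        have : ((n + 1 : ℕ) : ℕ∞) ≤ depth R R := le_depth_iff.mpr ⟨rs ++ [x], by simp [hl],
          fun r h => by
            rcases List.mem_append.mp h with h | h
            · exact hm r h
            · simpa [List.mem_singleton.mp h] using hx,
          (isWeaklyRegular_append_iff _ _ _).mpr
            ⟨hr, (isWeaklyRegular_singleton_iff _ _).mpr hreg⟩⟩
        rw [hn] at this
        have : n + 1 ≤ n := by exact_mod_cast this
        omega)
    refine ExtVanishes.of_injective hf ?_ (ih (i + 1) (by omega) (by omega) _)
    exact extVanishes_quotient_of_isWeaklyRegular hr (d := 0)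
      (fun j hj => .of_projective hj) i (by omega)

omit hR in
lemma not_extVanishes_residueField : ¬ ExtVanishes R (R ⧸ maximalIdeal R) R n := by
  intro h
  have hlt : maximalIdeal R • (⊤ : Submodule R (ModuleCat.of R R)) < ⊤ := by
    refine lt_top_iff_ne_top.mpr fun h => ?_
    exact (maximalIdeal.isMaximal R).ne_top (by simpa using h)
  have hκ : Module.support R (ModuleCat.of R (R ⧸ maximalIdeal R)) =
      PrimeSpectrum.zeroLocus (maximalIdeal R) := by
    rw [Module.support_eq_zeroLocus, Ideal.annihilator_quotient]
  obtain ⟨rs, hl, hm, hr⟩ := le_depth_iff.mp hn.ge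
  obtain ⟨rs', hl', hm', hr'⟩ := ModuleCat.exists_isRegular_of_exists_subsingleton_ext
    (maximalIdeal R) (n + 1) (ModuleCat.of R R) hlt (ModuleCat.of R (R ⧸ maximalIdeal R)) hκ
    (fun i hi => by
      rcases Nat.lt_succ_iff_lt_or_eq.mp hi with hi | rfl
      · exact ModuleCat.subsingleton_ext_of_exists_isRegular (maximalIdeal R) _ hκ.subset
          (ModuleCat.of R R) hlt rs hm (.of_isWeaklyRegular_of_mem_maximalIdeal R hm hr) i
          (by omega)
      · exact h)
  have : ((n + 1 : ℕ) : ℕ∞) ≤ depth R R :=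
    le_depth_iff.mpr ⟨rs', hl', hm', hr'.toIsWeaklyRegular⟩
  rw [hn] at this
  have : n + 1 ≤ n := by exact_mod_cast this
  omega

lemma exists_isSMulRegular_of_extVanishes (h : ExtVanishes R N R n) :
    ∃ x ∈ maximalIdeal R, IsSMulRegular N x := by
  by_contra! hx
  obtain ⟨f, hf⟩ := exists_residueField_embedding hx
  exact not_extVanishes_residueField hn
    (.of_injective hf h (extVanishes_of_depth_lt hR hn (by omega)))

/-- Over a Gorenstein local ring of depth `n`, a finitely generated module `N` has depth at
least `t` if and only if `Ext^i(N, R) = 0` for all `i > n - t`. -/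
lemma hasRegularSequence_iff_extVanishes {t : ℕ} :
    HasRegularSequence R N t ↔ ∀ i, n < i + t → ExtVanishes R N R i := by
  induction t generalizing N with
  | zero =>
    exact ⟨fun _ i hi => extVanishes_of_depth_lt hR hn hi, fun _ => hasRegularSequence_zero⟩
  | succ t ih =>
    rw [hasRegularSequence_succ_iff]
    constructor
    · rintro ⟨x, hx, hreg, h⟩ i hi
      exact .of_quotSMulTop hx hreg (ih.mp h (i + 1) (by omega))
    · intro h
      obtain ⟨x, hx, hreg⟩ := exists_isSMulRegular_of_extVanishes hR hn (h n (by omega))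
      refine ⟨x, hx, hreg, ih.mpr fun i hi => ?_⟩
      rcases Nat.eq_zero_or_pos i with rfl | hi0
      · have := subsingleton_of_extVanishes hR fun j => h j (by omega)
        exact .of_subsingleton 0
      · obtain ⟨j, rfl⟩ := Nat.exists_eq_succ_of_ne_zero hi0.ne'
        exact .quotSMulTop hreg (h j (by omega)) (h (j + 1) (by omega))

/-- The case of finite length in `smul_eq_zero_of_killsExt`: there `Ext^n(-, R)` is an exact
functor which does not kill nonzero modules. -/
lemma smul_eq_zero_of_killsExt_of_supportDim_le_zero (hdim : Module.supportDim R N ≤ 0) {r : R}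
    (hr : KillsExt r N R n) (x : N) : r • x = 0 := by
  set q : N →ₗ[R] N := LinearMap.lsmul R N r with hq
  -- the finite length modules have no lower `Ext`
  have hlow : ∀ (L : Submodule R N) (i : ℕ), i < n → ExtVanishes R L R i := by
    intro L i hi
    rcases subsingleton_or_nontrivial L with hL | hL
    · exact .of_subsingleton i
    have hL0 : Module.supportDim R L = 0 := by
      refine le_antisymm ((Module.supportDim_le_of_injective L.subtype
        Subtype.val_injective).trans hdim) ?_
      simpa using (hasRegularSequence_zero (R := R) (N := L)).le_supportDim
    obtain ⟨rs, hl, hm, hreg⟩ := le_depth_iff.mp hn.ge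
    refine ModuleCat.subsingleton_ext_of_exists_isRegular (maximalIdeal R) (ModuleCat.of R L)
      (support_of_supportDim_eq_zero R L hL0).subset (ModuleCat.of R R) ?_ rs hm
      (.of_isWeaklyRegular_of_mem_maximalIdeal R hm hreg) i (by omega)
    exact lt_top_iff_ne_top.mpr fun h => (maximalIdeal.isMaximal R).ne_top (by simpa using h)
  -- both maps in the factorization `N → rN → N` of `r` are controlled on `Ext^n`
  have hC : ExtVanishes R (LinearMap.range q) R n := by
    refine subsingleton_of_forall_eq 0 fun c => ?_
    obtain ⟨e, rfl⟩ := Ext.contravariant_sequence_exact₁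
      (shortExact_shortComplexOfExact (LinearMap.range q).injective_subtype
        (LinearMap.exact_subtype_mkQ (LinearMap.range q)) (Submodule.mkQ_surjective _))
      (ModuleCat.of R R) c (add_comm 1 n)
      ((extVanishes_of_depth_lt hR hn (N := N ⧸ LinearMap.range q) (i := n + 1)
        (by omega)).elim _ _)
    have hinj : ∀ c : Ext (ModuleCat.of R (LinearMap.range q)) (ModuleCat.of R R) n,
        (Ext.mk₀ (ModuleCat.ofHom q.rangeRestrict)).comp c (zero_add n) = 0 → c = 0 := by
      intro c hc
      rcases Nat.eq_zero_or_pos n with rfl | hn0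
      · have : Epi (ModuleCat.ofHom q.rangeRestrict) :=
          (ModuleCat.epi_iff_surjective _).mpr q.surjective_rangeRestrict
        exact Ext.precomp_mk₀_injective_of_epi (ModuleCat.of R R)
          (ModuleCat.ofHom q.rangeRestrict) (hc.trans (map_zero _).symm)
      · obtain ⟨m, rfl⟩ := Nat.exists_eq_succ_of_ne_zero hn0.ne'
        obtain ⟨y, rfl⟩ := Ext.contravariant_sequence_exact₃
          (shortExact_shortComplexOfExact (LinearMap.ker q.rangeRestrict).injective_subtype
            (LinearMap.exact_subtype_ker_map q.rangeRestrict) q.surjective_rangeRestrict)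
          (ModuleCat.of R R) c hc (add_comm 1 m)
        rw [(hlow (LinearMap.ker q.rangeRestrict) m (by omega)).elim y 0, Ext.comp_zero]
    refine hinj _ ?_
    exact (smul_ext_eq_of_comp_eq_smul (f := q.rangeRestrict) (g := (LinearMap.range q).subtype)
      (fun a => rfl) e).trans (hr e)
  have : Subsingleton (LinearMap.range q) := subsingleton_of_extVanishes hR fun i => by
    rcases lt_trichotomy i n with hi | rfl | hi
    · exact hlow _ i hi
    · exact hC
    · exact extVanishes_of_depth_lt hR hn hi
  exact congrArg Subtype.val (Subsingleton.elim (q.rangeRestrict x) 0)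

/-- Over a Gorenstein local ring of depth `n = l + j`, let `N` be a finitely generated module of
dimension at most `l` and depth at least `l`. Then `Ext^j(N, R)` has no larger annihilator than
`N`. -/
lemma smul_eq_zero_of_killsExt {l j : ℕ} (hlj : l + j = n)
    (hdim : Module.supportDim R N ≤ l) (hN : ∀ i, j < i → ExtVanishes R N R i) {r : R}
    (hr : KillsExt r N R j) (x : N) : r • x = 0 := by
  induction l generalizing N j with
  | zero =>
    obtain rfl : j = n := by omega
    exact smul_eq_zero_of_killsExt_of_supportDim_le_zero hR hn (by simpa using hdim) hr x
  | succ l ih =>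
    obtain ⟨y, hy, hreg⟩ := exists_isSMulRegular_of_extVanishes hR hn (hN n (by omega))
    -- by Krull's intersection theorem it suffices to treat the quotients `N / y^s N`
    have hmem : ∀ s : ℕ, r • x ∈ (y ^ s) • (⊤ : Submodule R N) := by
      intro s
      rcases Nat.eq_zero_or_pos s with rfl | hs
      · simp
      have hys : y ^ s ∈ maximalIdeal R := Ideal.pow_mem_of_mem _ hy s hs
      have hregs : IsSMulRegular N (y ^ s) := hreg.pow s
      have hd : Module.supportDim R (QuotSMulTop (y ^ s) N) ≤ l := by
        have h1 := Module.supportDim_quotSMulTop_succ_eq_supportDim hregs hys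
        rw [← h1] at hdim
        have h2 : Module.supportDim R (QuotSMulTop (y ^ s) N) + 1 ≤ (l : WithBot ℕ∞) + 1 := by
          simpa using hdim
        exact withBot_le_of_add_le_add (m := 1) (by simpa using h2)
      have := ih (N := QuotSMulTop (y ^ s) N) (j := j + 1) (by omega) hd (fun i hi => by
          obtain ⟨i, rfl⟩ := Nat.exists_eq_succ_of_ne_zero (n := i) (by omega)
          exact .quotSMulTop hregs (hN i (by omega)) (hN (i + 1) (by omega)))
        (KillsExt.right (f := LinearMap.lsmul R N (y ^ s)) hregs
          (LinearMap.exact_lsmul_mkQ_smul_top N (y ^ s)) (Submodule.mkQ_surjective _) hr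
          (hN (j + 1) (by omega))) (Submodule.Quotient.mk x)
      rwa [← Submodule.Quotient.mk_smul, Submodule.Quotient.mk_eq_zero] at this
    have hbot := Ideal.iInf_pow_smul_eq_bot_of_isLocalRing (M := N) (maximalIdeal R)
      (maximalIdeal.isMaximal R).ne_top
    have : r • x ∈ (⨅ s : ℕ, maximalIdeal R ^ s • ⊤ : Submodule R N) := by
      refine (Submodule.mem_iInf _).mpr fun s => ?_
      obtain ⟨z, -, hz⟩ := hmem s
      rw [← hz]
      exact Submodule.smul_mem_smul (Ideal.pow_mem_pow hy s) trivial
    rwa [hbot] at this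

end GorensteinLocal

/-! ### The dimension formula -/

section CohenMacaulay

variable {R : Type u} [CommRing R] [IsLocalRing R] [IsNoetherianRing R]

/-- The depth of a finitely generated module is at most the dimension of `R / p` for each
associated prime `p`. -/
lemma HasRegularSequence.le_ringKrullDim_quotient {t : ℕ} {N : Type u} [AddCommGroup N]
    [Module R N] [Module.Finite R N] (h : HasRegularSequence R N t) {p : Ideal R}
    (hp : p ∈ associatedPrimes R N) : (t : WithBot ℕ∞) ≤ ringKrullDim (R ⧸ p) := by
  induction t generalizing N p with
  | zero =>
    have := hp.isPrime
    exact_mod_cast ringKrullDim_nonneg_of_nontrivial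
  | succ t ih =>
    obtain ⟨x, hx, hreg, h⟩ := hasRegularSequence_succ_iff.mp h
    have hpp := hp.isPrime
    -- `p` and `x` annihilate a nonzero element of `N / xN`
    let U : Submodule R N := Submodule.torsionBySet R N p
    obtain ⟨z, hzU, hz⟩ : ∃ z ∈ U, z ∉ x • (⊤ : Submodule R N) := by
      by_contra! hU
      have hle : U ≤ maximalIdeal R • U := by
        intro z hz
        obtain ⟨w, -, rfl⟩ := hU z hz
        refine Submodule.smul_mem_smul hx ?_
        refine (Submodule.mem_torsionBySet_iff _ _).mpr fun a => hreg ?_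
        have := (Submodule.mem_torsionBySet_iff _ _).mp hz a
        change x • (a : R) • w = x • 0
        rw [smul_comm, smul_zero]
        exact this
      have hbot := Submodule.eq_bot_of_le_smul_of_le_jacobson_bot _ _
        (IsNoetherian.noetherian U) hle (maximalIdeal_le_jacobson _)
      obtain ⟨-, m, hm⟩ := isAssociatedPrime_iff.mp (AssociatedPrimes.mem_iff.mp hp)
      have hmU : m ∈ U := (Submodule.mem_torsionBySet_iff _ _).mpr fun a => by
        have ha : (a : R) ∈ (⊥ : Submodule R N).colon {m} := hm ▸ a.2
        simpa using ha
      rw [hbot, Submodule.mem_bot] at hmU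
      apply hpp.ne_top
      rw [hm, hmU, Ideal.eq_top_iff_one]
      simp
    have hz' : (Submodule.Quotient.mk z : QuotSMulTop x N) ≠ 0 := by
      rwa [Ne, Submodule.Quotient.mk_eq_zero]
    obtain ⟨q, hq, hqz⟩ := exists_le_isAssociatedPrime_of_isNoetherianRing R
      (Submodule.Quotient.mk z : QuotSMulTop x N) hz'
    have hqp := hq.isPrime
    have hxz : x • (Submodule.Quotient.mk z : QuotSMulTop x N) = 0 := by
      rw [← Submodule.Quotient.mk_smul, Submodule.Quotient.mk_eq_zero]
      exact ⟨z, trivial, rfl⟩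
    have hxq : x ∈ q := hqz (by simpa using hxz)
    have hpq : p ≤ q := fun a ha => hqz (by
      have : a • z = 0 := (Submodule.mem_torsionBySet_iff _ _).mp hzU ⟨a, ha⟩
      have h0 : a • (Submodule.Quotient.mk z : QuotSMulTop x N) = 0 := by
        rw [← Submodule.Quotient.mk_smul, this, Submodule.Quotient.mk_zero]
      simpa using h0)
    have hxp : x ∉ p := fun hxp => by
      have : x ∈ ⋃ p ∈ associatedPrimes R N, (p : Set R) := Set.mem_biUnion hp hxp
      rw [biUnion_associatedPrimes_eq_compl_regular] at this
      exact this hreg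
    have hstep : ringKrullDim (R ⧸ q) + 1 ≤ ringKrullDim (R ⧸ p) := by
      refine ringKrullDim_succ_le_of_surjective (Ideal.Quotient.factor hpq)
        (Ideal.Quotient.factor_surjective hpq) (r := Ideal.Quotient.mk p x) ?_ ?_
      · rw [mem_nonZeroDivisors_iff_ne_zero]
        rwa [Ne, Ideal.Quotient.eq_zero_iff_mem]
      · rwa [Ideal.Quotient.factor_mk, Ideal.Quotient.eq_zero_iff_mem]
    calc ((t + 1 : ℕ) : WithBot ℕ∞) = t + 1 := by push_cast; rfl
      _ ≤ ringKrullDim (R ⧸ q) + 1 := by gcongr; exact ih h hq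
      _ ≤ _ := hstep

omit [IsLocalRing R] in
lemma length_le_height_of_isWeaklyRegular {I : Ideal R} {rs : List R}
    (hr : IsWeaklyRegular R rs) (hm : ∀ r ∈ rs, r ∈ I) : (rs.length : ℕ∞) ≤ I.height := by
  rw [Ideal.height_eq_inf_minimalPrimes]
  refine le_iInf₂ fun p hp => ?_
  have hpp : p.IsPrime := hp.1.1
  have hreg := hr.isRegular_of_isLocalization_of_mem (Localization.AtPrime p) p
    fun r h => hp.1.2 (hm r h)
  have hle : HasRegularSequence (Localization.AtPrime p) (Localization.AtPrime p) rs.length :=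
    ⟨rs.map (algebraMap R _), by simp, fun r h => by
      obtain ⟨a, ha, rfl⟩ := List.mem_map.mp h
      exact (IsLocalization.AtPrime.to_map_mem_maximal_iff _ p a).mpr (hp.1.2 (hm a ha)),
      hreg.toIsWeaklyRegular⟩
  have := IsLocalization.isNoetherianRing p.primeCompl (Localization.AtPrime p) inferInstance
  have h := hle.le_supportDim
  rw [Module.supportDim_self_eq_ringKrullDim,
    IsLocalization.AtPrime.ringKrullDim_eq_height p] at h
  exact_mod_cast h

omit [IsLocalRing R] [IsNoetherianRing R] in
lemma height_add_ringKrullDim_quotient_le (p : Ideal R) [hp : p.IsPrime] :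
    (p.height : WithBot ℕ∞) + ringKrullDim (R ⧸ p) ≤ ringKrullDim R := by
  have : Nonempty (PrimeSpectrum R) := ⟨⟨p, hp⟩⟩
  have h1 : ringKrullDim (R ⧸ p) = Order.coheight (⟨p, hp⟩ : PrimeSpectrum R) := by
    rw [ringKrullDim_quotient, Order.coheight_eq_krullDim_Ici]
    rfl
  rw [h1, ringKrullDim, Order.krullDim_eq_iSup_height_add_coheight_of_nonempty,
    PrimeSpectrum.height_eq_orderHeight ⟨p, hp⟩]
  exact_mod_cast le_iSup (fun a : PrimeSpectrum R => Order.height a + Order.coheight a) ⟨p, hp⟩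

/-- The dimension formula for a proper ideal of a Gorenstein local ring of dimension `n`. -/
lemma exists_ringKrullDim_quotient_eq (hR : HasFiniteSelfInjectiveDimension R) {n : ℕ}
    (hn : depth R R = n) (hdim : ringKrullDim R = n) {I : Ideal R} (hI : I ≠ ⊤) {k : ℕ}
    (hk : I.height = k) : ∃ e : ℕ, ringKrullDim (R ⧸ I) = e ∧ e + k = n := by
  have hbound : ∀ rs : List R, (∀ r ∈ rs, r ∈ I) → IsWeaklyRegular R rs → rs.length ≤ k := by
    intro rs hm hr
    exact_mod_cast hk ▸ length_le_height_of_isWeaklyRegular hr hm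
  -- a regular sequence in `I` that cannot be prolonged inside `I`; let `g` be its length
  obtain ⟨rs, hm, hr, hmax⟩ : ∃ rs : List R, (∀ r ∈ rs, r ∈ I) ∧ IsWeaklyRegular R rs ∧
      ∀ x ∈ I, ¬ IsWeaklyRegular R (rs ++ [x]) := by
    by_contra! H
    have hall : ∀ m : ℕ, ∃ rs : List R, rs.length = m ∧ (∀ r ∈ rs, r ∈ I) ∧
        IsWeaklyRegular R rs := by
      intro m
      induction m with
      | zero => exact ⟨[], rfl, by simp, .nil R R⟩
      | succ m ih =>
        obtain ⟨rs, hl, hm, hr⟩ := ih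
        obtain ⟨x, hx, hr'⟩ := H rs hm hr
        refine ⟨rs ++ [x], by simp [hl], fun r h => ?_, hr'⟩
        rcases List.mem_append.mp h with h | h
        · exact hm r h
        · simpa [List.mem_singleton.mp h] using hx
    obtain ⟨rs, hl, hm, hr⟩ := hall (k + 1)
    have := hbound rs hm hr
    omega
  have hg := hbound rs hm hr
  have hIm : I ≤ maximalIdeal R := le_maximalIdeal hI
  let Q : Type u := R ⧸ Ideal.ofList rs • (⊤ : Submodule R R)
  -- maximality puts `I` into an associated prime of the quotient `Q`
  obtain ⟨p, hp, hIp⟩ : ∃ p ∈ associatedPrimes R Q, I ≤ p := by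
    refine (Ideal.subset_union_prime_finite (associatedPrimes.finite R Q) I I
      (fun p hp _ _ => hp.isPrime)).mp fun x hx => ?_
    refine (biUnion_associatedPrimes_eq_compl_regular R Q).symm ▸ fun hreg => ?_
    exact hmax x hx ((isWeaklyRegular_append_iff _ _ _).mpr
      ⟨hr, (isWeaklyRegular_singleton_iff _ _).mpr hreg⟩)
  have hpp := hp.isPrime
  have hgn : rs.length ≤ n := by
    have : (rs.length : ℕ∞) ≤ depth R R :=
      le_depth_iff.mpr ⟨rs, rfl, fun r h => hIm (hm r h), hr⟩
    rw [hn] at this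
    exact_mod_cast this
  have hdepth : HasRegularSequence R Q (n - rs.length) :=
    (hasRegularSequence_iff_extVanishes hR hn).mpr fun i hi =>
      extVanishes_quotient_of_isWeaklyRegular hr (d := 0) (fun j hj => .of_projective hj) i
        (by omega)
  have h1 := hdepth.le_ringKrullDim_quotient hp
  have h2 : ringKrullDim (R ⧸ p) ≤ ringKrullDim (R ⧸ I) :=
    ringKrullDim_le_of_surjective (Ideal.Quotient.factor hIp)
      (Ideal.Quotient.factor_surjective hIp)
  -- the inequalities `k + dim R / p ≤ n` and `n - g ≤ dim R / p` give `k ≤ g`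
  have hkg : k ≤ rs.length := by
    have h3 := height_add_ringKrullDim_quotient_le p
    have h4 : ((k : ℕ∞) : WithBot ℕ∞) ≤ p.height := by
      rw [← hk]
      exact_mod_cast Ideal.height_mono hIp
    have h5 : ((k + (n - rs.length) : ℕ) : WithBot ℕ∞) ≤ n := by
      rw [← hdim]
      refine le_trans ?_ h3
      push_cast
      exact add_le_add h4 h1
    have h6 : k + (n - rs.length) ≤ n := by exact_mod_cast h5
    omega
  have hup : ringKrullDim (R ⧸ I) + (rs.length : ℕ) ≤ n := by
    have hreg := IsRegular.of_isWeaklyRegular_of_mem_maximalIdeal R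
      (fun r h => hIm (hm r h)) hr
    rw [← hdim, ← Module.supportDim_self_eq_ringKrullDim (R := R),
      ← Module.supportDim_add_length_eq_supportDim_of_isRegular rs hreg]
    gcongr
    rw [← Module.supportDim_quotient_eq_ringKrullDim]
    have hle : Ideal.ofList rs • (⊤ : Submodule R R) ≤ I := by
      refine Submodule.smul_le.mpr fun a ha b _ => I.mul_mem_right b ?_
      exact Ideal.span_le.mpr hm ha
    exact Module.supportDim_le_of_surjective (Submodule.factor hle)
      (Submodule.factor_surjective hle)
  obtain rfl : rs.length = k := le_antisymm hg hkg
  refine ⟨n - rs.length, le_antisymm ?_ (h1.trans h2), by omega⟩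
  refine withBot_le_of_add_le_add (m := rs.length) (hup.trans ?_)
  exact_mod_cast (by omega : n ≤ n - rs.length + rs.length)

end CohenMacaulay

/-! ### Maximal Cohen-Macaulay modules over a quotient -/

section Quotient

variable {R : Type u} [CommRing R] [IsLocalRing R] {I : Ideal R} [IsLocalRing (R ⧸ I)]
  {W : Type u} [AddCommGroup W] [Module R W] [Module (R ⧸ I) W] [IsScalarTower R (R ⧸ I) W]

lemma hasRegularSequence_quotient_iff {t : ℕ} :
    HasRegularSequence (R ⧸ I) W t ↔ HasRegularSequence R W t := by
  have hloc : IsLocalHom (Ideal.Quotient.mk I) :=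
    .of_surjective _ Ideal.Quotient.mk_surjective
  have hmem : ∀ r : R, Ideal.Quotient.mk I r ∈ maximalIdeal (R ⧸ I) ↔ r ∈ maximalIdeal R := by
    intro r
    simp only [mem_maximalIdeal, mem_nonunits_iff, isUnit_map_iff]
  constructor
  · rintro ⟨rs, hl, hm, hr⟩
    obtain ⟨rs, rfl⟩ : ∃ rs' : List R, rs'.map (Ideal.Quotient.mk I) = rs :=
      List.map_surjective_iff.mpr Ideal.Quotient.mk_surjective rs
    refine ⟨rs, by simpa using hl, fun r h => (hmem r).mp (hm _ (List.mem_map_of_mem h)), ?_⟩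
    exact (isWeaklyRegular_map_algebraMap_iff (R ⧸ I) W rs).mp hr
  · rintro ⟨rs, hl, hm, hr⟩
    refine ⟨rs.map (Ideal.Quotient.mk I), by simpa using hl, fun r h => ?_, ?_⟩
    · obtain ⟨a, ha, rfl⟩ := List.mem_map.mp h
      exact (hmem a).mpr (hm a ha)
    · exact (isWeaklyRegular_map_algebraMap_iff (R ⧸ I) W rs).mpr hr

/-- Over a Noetherian local ring of dimension `e`, a nonzero finitely generated module is maximal
Cohen-Macaulay as soon as its depth is at least `e`. -/
lemma isMaximalCohenMacaulay_iff {A : Type u} [CommRing A] [IsLocalRing A] [IsNoetherianRing A]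
    {N : Type u} [AddCommGroup N] [Module A N] [Module.Finite A N] [Nontrivial N] {e : ℕ}
    (he : ringKrullDim A = e) : IsMaximalCohenMacaulay A N ↔ HasRegularSequence A N e := by
  constructor
  · intro h
    have : ((e : ℕ∞) : WithBot ℕ∞) = depth A N := by
      rw [h.depth_eq, h.supportDim_eq, he]
      rfl
    exact le_depth_iff.mp (by exact_mod_cast this.le)
  · intro h
    have hs : Module.supportDim A N = e :=
      le_antisymm (he ▸ Module.supportDim_le_ringKrullDim A N) h.le_supportDim
    have hd : depth A N = e := by
      refine le_antisymm (not_lt.mp fun hlt => ?_) (le_depth_iff.mpr h)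
      have h1 : ((e + 1 : ℕ) : ℕ∞) ≤ depth A N := by
        exact_mod_cast Order.add_one_le_of_lt hlt
      have h2 := (le_depth_iff.mp h1).le_supportDim
      rw [hs] at h2
      have h3 : e + 1 ≤ e := by exact_mod_cast h2
      omega
    exact ⟨inferInstance, by rw [hd, hs]; rfl, hs.trans he.symm⟩

/-- For an `R / I`-module over a Gorenstein local ring `R`, where `I` has height `k`, being
maximal Cohen-Macaulay is the vanishing of `Ext^i(W, R)` for `i > k`. -/
lemma isMaximalCohenMacaulay_quotient_iff [IsNoetherianRing R]
    (hR : HasFiniteSelfInjectiveDimension R) {n e k : ℕ} (hn : depth R R = n)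
    (he : ringKrullDim (R ⧸ I) = e) (hek : e + k = n) [Module.Finite R W] [Nontrivial W] :
    IsMaximalCohenMacaulay (R ⧸ I) W ↔ ∀ i, k < i → ExtVanishes R W R i := by
  have : Module.Finite (R ⧸ I) W := Module.Finite.of_restrictScalars_finite R (R ⧸ I) W
  rw [isMaximalCohenMacaulay_iff he, hasRegularSequence_quotient_iff,
    hasRegularSequence_iff_extVanishes hR hn]
  exact forall_congr' fun i => by rw [← hek, add_comm i, Nat.add_lt_add_iff_left]

end Quotient

/-! ### Ideal multiples of free modules -/

section FreeModules

variable {R : Type u} [CommRing R]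

lemma ExtVanishes.pi {A Y : Type u} [AddCommGroup A] [Module R A] [AddCommGroup Y] [Module R Y]
    {i : ℕ} (h : ExtVanishes R A Y i) (m : ℕ) : ExtVanishes R (Fin m → A) Y i := by
  induction m with
  | zero => exact .of_subsingleton i
  | succ m ih =>
    refine ExtVanishes.middle (f := LinearMap.single R (fun _ : Fin (m + 1) => A) 0)
      (g := LinearMap.funLeft R A Fin.succ)
      (Pi.single_injective (M := fun _ : Fin (m + 1) => A) 0) ?_ ?_ h ih
    · intro x
      constructor
      · intro hx
        refine ⟨x 0, funext fun j => ?_⟩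
        refine Fin.cases ?_ (fun j => ?_) j
        · simp
        · simpa using (congrFun hx j).symm
      · rintro ⟨a, rfl⟩
        ext j
        simp [LinearMap.funLeft]
    · exact LinearMap.funLeft_surjective_of_injective _ _ _ (Fin.succ_injective m)

variable {F : Type u} [AddCommGroup F] [Module R F] {I : Ideal R}

lemma mem_smul_top_iff_repr {κ : Type*} (b : Module.Basis κ R F) (x : F) :
    x ∈ (I • ⊤ : Submodule R F) ↔ ∀ j, b.repr x j ∈ I := by
  rw [← b.span_eq, Submodule.mem_ideal_smul_span_iff_exists_sum]
  constructor
  · rintro ⟨a, ha, rfl⟩ j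
    have : b.repr (a.sum fun i c => c • b i) = a := b.repr_linearCombination a
    rw [this]
    exact ha j
  · exact fun h => ⟨b.repr x, h, b.linearCombination_repr x⟩

/-- If `I ≠ 0` and `IF` is finitely generated, then the free module `F` has finite rank. -/
lemma finite_of_finite_smul_top [Module.Free R F] (hI : I ≠ ⊥)
    [Module.Finite R (I • ⊤ : Submodule R F)] : Module.Finite R F := by
  classical
  obtain ⟨a, haI, ha⟩ := Submodule.exists_mem_ne_zero_of_ne_bot hI
  let b := Module.Free.chooseBasis R F
  obtain ⟨s, hs⟩ := (Module.Finite.iff_fg.mp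
    (inferInstance : Module.Finite R (I • ⊤ : Submodule R F)))
  -- a finite set of generators of `IF` involves only finitely many basis elements
  let t := s.biUnion fun x => (b.repr x).support
  have hle : (I • ⊤ : Submodule R F) ≤
      (Finsupp.supported R R (t : Set (Module.Free.ChooseBasisIndex R F))).comap
        b.repr.toLinearMap := by
    rw [← hs, Submodule.span_le]
    intro x hx j hj
    exact Finset.mem_coe.mpr (Finset.mem_biUnion.mpr ⟨x, hx, hj⟩)
  have hall : ∀ j, j ∈ t := by
    intro j
    have h1 : a • b j ∈ (I • ⊤ : Submodule R F) := Submodule.smul_mem_smul haI trivial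
    have h2 := hle h1
    refine h2 (Finset.mem_coe.mpr (Finsupp.mem_support_iff.mpr ?_))
    simpa using ha
  have : Finite (Module.Free.ChooseBasisIndex R F) :=
    Set.finite_univ_iff.mp (t.finite_toSet.subset fun j _ => hall j)
  exact Module.Finite.of_basis b

lemma ExtVanishes.smul_top [IsLocalRing R] [Module.Free R F] [Module.Finite R F]
    {Y : Type u} [AddCommGroup Y] [Module R Y] {i : ℕ} (hi : 0 < i)
    (h : ExtVanishes R (R ⧸ I) Y (i + 1)) :
    ExtVanishes R (I • ⊤ : Submodule R F) Y i := by
  let b := Module.finBasis R F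
  let q : F →ₗ[R] (Fin (Module.finrank R F) → R ⧸ I) :=
    LinearMap.pi fun j => I.mkQ ∘ₗ b.coord j
  refine ExtVanishes.left (f := (I • ⊤ : Submodule R F).subtype) (g := q)
    Subtype.val_injective (fun x => ?_) (fun y => ?_) (.of_projective hi) (h.pi _)
  · have hq : q x = 0 ↔ ∀ j, b.repr x j ∈ I := by
      simp only [funext_iff, q, LinearMap.pi_apply, LinearMap.comp_apply, Pi.zero_apply,
        Submodule.mkQ_apply, Submodule.Quotient.mk_eq_zero, Module.Basis.coord_apply]
    rw [hq, ← mem_smul_top_iff_repr]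
    simp
  · choose c hc using fun j => I.mkQ_surjective (y j)
    refine ⟨b.equivFun.symm c, funext fun j => ?_⟩
    rw [← hc j]
    exact congrArg I.mkQ (congrFun (b.equivFun.apply_symm_apply c) j)

end FreeModules

/-! ### Canonical modules -/

section Canonical

variable {R : Type u} [CommRing R]

/-- Over a Noetherian ring of finite self-injective dimension, a totally reflexive module embeds
into a projective module with totally reflexive cokernel. -/
lemma exists_free_coresolution [IsNoetherianRing R] (hR : HasFiniteSelfInjectiveDimension R)
    {G : Type u} [AddCommGroup G] [Module R G] [Module.Finite R G]
    (hG : ∀ i, 0 < i → ExtVanishes R G R i) :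
    ∃ (P C : Type u) (_ : AddCommGroup P) (_ : Module R P) (_ : Module.Projective R P)
      (_ : AddCommGroup C) (_ : Module R C) (_ : Module.Finite R C)
      (f : G →ₗ[R] P) (g : P →ₗ[R] C), Function.Injective f ∧ Function.Exact f g ∧
        Function.Surjective g ∧ ∀ i, 0 < i → ExtVanishes R C R i := by
  have hrefl := (isTotallyReflexive_of_extVanishes hR hG).isReflexive
  have hdual := extVanishes_dual hR hG
  obtain ⟨m, K, _, _, _, f, g, hf, h, hg⟩ := exists_finite_free_cover R (Module.Dual R G)
  obtain ⟨hf', h', hg'⟩ := dual_shortExact hf h hg (hdual 1 one_pos)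
  have hK : ∀ i, 0 < i → ExtVanishes R K R i := fun i hi =>
    .left hf h hg (.of_projective hi) (hdual (i + 1) (by omega))
  refine ⟨Module.Dual R (Fin m → R), Module.Dual R K, inferInstance, inferInstance, inferInstance,
    inferInstance, inferInstance, inferInstance, g.dualMap ∘ₗ Module.Dual.eval R G, f.dualMap,
    hf'.comp (Module.bijective_dual_eval R G).1, ?_, hg', extVanishes_dual hR hK⟩
  intro φ
  rw [h' φ]
  constructor
  · rintro ⟨ψ, rfl⟩
    obtain ⟨x, rfl⟩ := (Module.bijective_dual_eval R G).2 ψ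
    exact ⟨x, rfl⟩
  · rintro ⟨x, rfl⟩
    exact ⟨_, rfl⟩

/-- A totally reflexive module has no higher extensions by a module of finite injective
dimension, because it is an arbitrarily high syzygy. -/
lemma extVanishes_of_injectiveDimensionLE [IsNoetherianRing R]
    (hR : HasFiniteSelfInjectiveDimension R) {Y : Type u} [AddCommGroup Y] [Module R Y]
    (hY : ∃ d : ℕ, HasInjectiveDimensionLE (ModuleCat.of R Y) d)
    {G : Type u} [AddCommGroup G] [Module R G] [Module.Finite R G]
    (hG : ∀ i, 0 < i → ExtVanishes R G R i) {i : ℕ} (hi : 0 < i) : ExtVanishes R G Y i := by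
  obtain ⟨d, hd⟩ := exists_extVanishes_of_injectiveDimensionLE hY
  suffices H : ∀ (c i : ℕ), 0 < i → d < i + c → ∀ (G : Type u) [AddCommGroup G] [Module R G]
      [Module.Finite R G], (∀ i, 0 < i → ExtVanishes R G R i) → ExtVanishes R G Y i from
    H (d + 1) i hi (by omega) G hG
  intro c
  induction c with
  | zero => exact fun i _ hi' G _ _ _ _ => hd i (by omega) G
  | succ c ih =>
    intro i hi hi' G _ _ _ hG
    obtain ⟨P, C, _, _, _, _, _, _, f, g, hf, h, hg, hC⟩ := exists_free_coresolution hR hG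
    exact .left hf h hg (.of_projective hi) (ih (i + 1) (by omega) (by omega) C hC)

/-- `Ext^t(N, -)` turns a module with a finite basis into a power of `Ext^t(N, R)`. -/
def extEquivOfBasis (N : ModuleCat.{u} R) {ω : Type u} [AddCommGroup ω] [Module R ω] {m : ℕ}
    (b : Module.Basis (Fin m) R ω) (t : ℕ) :
    Ext N (ModuleCat.of R ω) t ≃ₗ[R] (Fin m → Ext N (ModuleCat.of R R) t) :=
  LinearEquiv.ofLinearMap
    (LinearMap.pi fun j => Ext.postcompOfLinear (Ext.mk₀ (ModuleCat.ofHom (b.coord j))) R N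
      (add_zero t))
    (∑ j, Ext.postcompOfLinear (Ext.mk₀ (ModuleCat.ofHom (LinearMap.toSpanSingleton R ω (b j))))
      R N (add_zero t) ∘ₗ LinearMap.proj j)
    (by
      refine LinearMap.ext fun x => funext fun l => ?_
      have h : ∀ j, ModuleCat.ofHom (LinearMap.toSpanSingleton R ω (b j)) ≫
          ModuleCat.ofHom (b.coord l) = if j = l then 𝟙 (ModuleCat.of R R) else 0 := by
        intro j
        split_ifs with hjl
        · subst hjl
          ext
          simp
        · ext
          simp [Finsupp.single_eq_of_ne' hjl]
      have hsum : ∑ j, (x j).comp (Ext.mk₀ (if j = l then 𝟙 (ModuleCat.of R R) else 0))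
          (add_zero t) = x l := by
        rw [Finset.sum_eq_single l (fun j _ hj => by simp [hj]) (by simp)]
        simp
      simpa [h] using hsum)
    (by
      refine LinearMap.ext fun x => ?_
      have h : ∑ j, ModuleCat.ofHom (b.coord j) ≫
          ModuleCat.ofHom (LinearMap.toSpanSingleton R ω (b j)) = 𝟙 (ModuleCat.of R ω) := by
        ext y
        simp [b.sum_repr]
      simp [← Ext.comp_sum,
        ← Ext.mk₀_sum, h])

variable [IsLocalRing R]

/-- Over a Gorenstein local ring, the only canonical module is the ring itself. -/
lemma nonempty_linearEquiv_of_isCanonicalModule [IsNoetherianRing R]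
    (hR : HasFiniteSelfInjectiveDimension R) {n : ℕ} (hn : depth R R = n)
    (hdim : ringKrullDim R = n) {ω : Type u} [AddCommGroup ω] [Module R ω]
    (hω : IsCanonicalModule R ω) : Nonempty (ω ≃ₗ[R] R) := by
  have hfin := hω.isMaximalCohenMacaulay.finite
  have hnt : Nontrivial ω := by
    rw [← Module.supportDim_ne_bot_iff_nontrivial R, hω.isMaximalCohenMacaulay.supportDim_eq, hdim]
    exact WithBot.coe_ne_bot
  have hext := (hasRegularSequence_iff_extVanishes hR hn).mp
    ((isMaximalCohenMacaulay_iff hdim).mp hω.isMaximalCohenMacaulay)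
  obtain ⟨P, C, _, _, _, _, _, _, f, g, hf, h, hg, hC⟩ :=
    exists_free_coresolution hR (G := ω) fun i hi => hext i (by omega)
  -- the embedding of `ω` into a projective module splits
  obtain ⟨r, hr⟩ := (extVanishes_of_injectiveDimensionLE hR hω.exists_injectiveDimensionLE hC
    one_pos).exists_extension hf h hg LinearMap.id
  have : Module.Projective R ω := .of_split f r hr
  have : Module.Free R ω := Module.free_of_flat_of_isLocalRing
  let b := Module.finBasis R ω
  -- the type of `ω` is a multiple of its rank
  have hlen := hω.type_eq_one
  rw [cohenMacaulayType, (extEquivOfBasis _ b _).length_eq, Module.length_pi] at hlen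
  have hrank : Module.finrank R ω = 1 := by
    rw [ENat.card_eq_coe_fintype_card, Fintype.card_fin] at hlen
    generalize Module.length R (Ext (ModuleCat.of R (ResidueField R)) (ModuleCat.of R R)
      (depth R ω).toNat) = l at hlen
    induction l using ENat.recTopCoe with
    | top =>
      exfalso
      rcases Nat.eq_zero_or_pos (Module.finrank R ω) with h0 | h0
      · simp [h0] at hlen
      · rw [ENat.mul_top (by exact_mod_cast h0.ne')] at hlen
        exact absurd hlen (by simp)
    | coe l => exact Nat.eq_one_of_mul_eq_one_right (n := l) (by exact_mod_cast hlen)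
  exact ⟨(Module.finBasisOfFinrankEq R ω hrank).equivFun.trans
    (LinearEquiv.funUnique (Fin 1) R R)⟩

lemma lTensor_mkQ_injective {A : Type u} [CommRing A] {I : Ideal A} {N : Type u} [AddCommGroup N]
    [Module A N] {L : Submodule A N} (hL : L ≤ I • ⊤) :
    Function.Injective (L.mkQ.lTensor (A ⧸ I)) := by
  refine (injective_iff_map_eq_zero _).mpr fun z hz => ?_
  obtain ⟨y, rfl⟩ := (_root_.lTensor_exact (A ⧸ I) (LinearMap.exact_subtype_mkQ L)
    L.mkQ_surjective z).mp hz
  have h0 : L.subtype.lTensor (A ⧸ I) = 0 := by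
    refine TensorProduct.ext' fun a x => ?_
    have hx : ∀ y ∈ (I • ⊤ : Submodule A N), a ⊗ₜ[A] y = 0 := by
      intro y hy
      induction hy using Submodule.smul_induction_on' with
      | smul r hr y _ =>
        obtain ⟨c, rfl⟩ := Ideal.Quotient.mk_surjective a
        have : r • Ideal.Quotient.mk I c = 0 := by
          rw [Algebra.smul_def, Ideal.Quotient.algebraMap_eq, Ideal.Quotient.eq_zero_iff_mem.mpr hr,
            zero_mul]
        rw [← TensorProduct.smul_tmul, this, TensorProduct.zero_tmul]
      | add y _ z _ hy hz => rw [TensorProduct.tmul_add, hy, hz, add_zero]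
    exact hx x (hL x.2)
  rw [h0, LinearMap.zero_apply]

end Canonical

/-! ### The image of `λ` -/

section Approximation

variable {R : Type u} [CommRing R] [IsLocalRing R] {I : Ideal R}
  {F M W ω : Type u} [AddCommGroup F] [Module R F] [Module.Free R F]
  [AddCommGroup M] [Module R M] [AddCommGroup W] [Module R W]
  [AddCommGroup ω] [Module R ω]

/-- If `F` has finite rank and `ω` is free of rank one, then a linear map `F → ω` outside
`I Hom(F, ω)` has a value outside `I ω` on some basis vector. -/
lemma exists_notMem_of_notMem_smul_top [Module.Finite R F] (e : ω ≃ₗ[R] R) {φ : F →ₗ[R] ω}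
    (hφ : φ ∉ (I • ⊤ : Submodule R (F →ₗ[R] ω))) : ∃ x : F, e (φ x) ∉ I := by
  by_contra! hall
  refine hφ ?_
  let b := Module.finBasis R F
  have hsum : φ = ∑ j, e (φ (b j)) • (e.symm.toLinearMap ∘ₗ b.coord j) := by
    refine b.ext fun l => e.injective ?_
    rw [LinearMap.sum_apply, map_sum, Finset.sum_eq_single l]
    · simp
    · intro j _ hj
      simp [Finsupp.single_eq_of_ne hj]
    · simp
  rw [hsum]
  exact Submodule.sum_mem _ fun j _ => Submodule.smul_mem_smul (hall _) trivial

omit [IsLocalRing R] [Module.Free R F] in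
/-- If `φ : F → ω` lies in the image of `λ`, then multiplication by any value of `φ` on the
ideal `I` factors through `M`. -/
lemma exists_factorization_of_mem_rangeLambda (s : IFreeApproximation I F M W) (e : ω ≃ₗ[R] R)
    {φ : F →ₗ[R] ω} (hφ : φ ∈ s.rangeLambda ω) (x : F) :
    ∃ (f : I →ₗ[R] M) (g : M →ₗ[R] I), ∀ a, g (f a) = e (φ x) • a := by
  obtain ⟨ψ, hψ⟩ := hφ
  have hmem : ∀ a : I, (a : R) • x ∈ (I • ⊤ : Submodule R F) := fun a =>
    Submodule.smul_mem_smul a.2 trivial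
  have heI : ∀ y : (I • ⊤ : Submodule R ω), e y ∈ I := by
    intro y
    have h1 : e y ∈ (I • ⊤ : Submodule R ω).map e.toLinearMap := ⟨y, y.2, rfl⟩
    rw [Submodule.map_smul''] at h1
    exact Submodule.smul_le.mpr (fun a ha c _ => I.mul_mem_right c ha) h1
  refine ⟨s.ι ∘ₗ ((LinearMap.toSpanSingleton R F x ∘ₗ I.subtype).codRestrict _ hmem),
    ((e.toLinearMap ∘ₗ Submodule.subtype _).codRestrict I heI) ∘ₗ ψ, fun a => ?_⟩
  refine Subtype.ext ?_
  have h := LinearMap.congr_fun hψ ⟨(a : R) • x, hmem a⟩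
  have h' : (ψ (s.ι ⟨(a : R) • x, hmem a⟩) : ω) = φ ((a : R) • x) := congrArg Subtype.val h
  calc e (ψ (s.ι ⟨(a : R) • x, hmem a⟩)) = e (φ ((a : R) • x)) := by rw [h']
    _ = e (φ x) • (a : R) := by rw [map_smul, map_smul, smul_eq_mul, smul_eq_mul, mul_comm]

end Approximation

end ResidualDuality

end

theorem lemma2
    (R : Type u) [CommRing R] [IsLocalRing R]
    (hR : ResidualDuality.IsCohenMacaulayLocalRing R)
    (hGor : ResidualDuality.IsGorensteinLocalRing R)
    (I : Ideal R) (k : ℕ) (hk : I.height = k) (hk2 : 2 ≤ k)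
    [IsLocalRing (R ⧸ I)] (hRI : ResidualDuality.IsCohenMacaulayLocalRing (R ⧸ I))
    (F M W : Type u)
    [AddCommGroup F] [Module R F] [Module.Free R F]
    [AddCommGroup M] [Module R M] [Module.Finite R M]
    [AddCommGroup W] [Module R W] [Module (R ⧸ I) W] [IsScalarTower R (R ⧸ I) W]
    [Nontrivial W]
    (s : ResidualDuality.IFreeApproximation I F M W) :
    (ResidualDuality.IsMaximalCohenMacaulay (R ⧸ I) W ↔
        ResidualDuality.gorensteinDim R M ≤ k) ∧
    (ResidualDuality.IsMaximalCohenMacaulay (R ⧸ I) W →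
        (ResidualDuality.gorensteinDim R M ≤ ((k - 1 : ℕ) : ℕ∞) ↔
          Subsingleton (CategoryTheory.Abelian.Ext
            (ModuleCat.of R M) (ModuleCat.of R R) k))) ∧
    (ResidualDuality.IsGorensteinLocalRing (R ⧸ I) →
      ∀ (ω : Type u) [AddCommGroup ω] [Module R ω],
        ResidualDuality.IsCanonicalModule R ω →
        ¬ Function.Injective (s.alphaBar ω) →
        ((k - 1 : ℕ) : ℕ∞) ≤ ResidualDuality.gorensteinDim R M) := by
  open ResidualDuality in
  have hNoeth := hR.isNoetherianRing
  have hinj : HasFiniteSelfInjectiveDimension R := hGor.exists_injectiveDimensionLE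
  -- `R` has finite dimension `n`, and `R / I` has dimension `n - k`
  obtain ⟨n, hdim⟩ : ∃ n : ℕ, ringKrullDim R = n := by
    have h1 : ringKrullDim R ≠ ⊤ := ringKrullDim_ne_top
    have h2 : ringKrullDim R ≠ ⊥ := ringKrullDim_ne_bot
    obtain ⟨a, ha⟩ := WithBot.ne_bot_iff_exists.mp h2
    rw [← ha] at h1 ⊢
    have h3 : a ≠ ⊤ := by
      rintro rfl
      exact h1 rfl
    obtain ⟨n, rfl⟩ := ENat.ne_top_iff_exists.mp h3
    exact ⟨n, rfl⟩
  have hn : depth R R = n := by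
    have := hR.depth_eq
    rw [hdim] at this
    exact_mod_cast this
  have hItop : I ≠ ⊤ := Ideal.Quotient.nontrivial_iff.mp inferInstance
  obtain ⟨e, he, hek⟩ := exists_ringKrullDim_quotient_eq hinj hn hdim hItop hk
  have hWf : Module.Finite R W := .of_surjective s.ρ s.surjective_ρ
  -- `F` has finite rank, and `Ext^i(IF, R) = 0` for `i ≥ k`
  have hIF : Module.Finite R (I • ⊤ : Submodule R F) := .of_injective s.ι s.injective_ι
  have hI0 : I ≠ ⊥ := by
    rintro rfl
    rw [Ideal.height_bot] at hk
    have : k = 0 := by exact_mod_cast hk.symm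
    omega
  have hFf : Module.Finite R F := finite_of_finite_smul_top (F := F) hI0
  have hRIext : ∀ i, k < i → ExtVanishes R (R ⧸ I) R i := by
    have hd : HasRegularSequence (R ⧸ I) (R ⧸ I) e := by
      refine le_depth_iff.mp ?_
      have := hRI.depth_eq
      rw [he] at this
      have h : depth (R ⧸ I) (R ⧸ I) = e := by exact_mod_cast this
      exact h.ge
    have := (hasRegularSequence_iff_extVanishes hinj hn).mp (hasRegularSequence_quotient_iff.mp hd)
    exact fun i hi => this i (by omega)
  have hIFext : ∀ i, k ≤ i → ExtVanishes R (I • ⊤ : Submodule R F) R i := fun i hi =>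
    .smul_top (by omega) (hRIext (i + 1) (by omega))
  have hMW : ∀ i, k < i → (ExtVanishes R W R i ↔ ExtVanishes R M R i) := by
    intro i hi
    obtain ⟨j, rfl⟩ := Nat.exists_eq_succ_of_ne_zero (n := i) (by omega)
    exact ⟨fun h => .middle s.injective_ι s.exact s.surjective_ρ (hIFext _ (by omega)) h,
      fun h => .right s.injective_ι s.exact s.surjective_ρ (hIFext j (by omega)) h⟩
  have hMCM : IsMaximalCohenMacaulay (R ⧸ I) W ↔ ∀ i, k < i → ExtVanishes R M R i := by
    rw [isMaximalCohenMacaulay_quotient_iff hinj hn he hek]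
    exact forall₂_congr hMW
  refine ⟨hMCM.trans (gorensteinDim_le_iff hinj k).symm, fun hW => ?_, ?_⟩
  · rw [gorensteinDim_le_iff hinj]
    refine ⟨fun h => h k (by omega), fun h i hi => ?_⟩
    rcases Nat.eq_or_lt_of_le (show k ≤ i by omega) with rfl | hi'
    · exact h
    · exact hMCM.mp hW i hi'
  · intro _ ω _ _ hω hα
    by_contra hlt
    have hM : ∀ i, k - 2 < i → ExtVanishes R M R i := by
      rw [← gorensteinDim_le_iff hinj]
      have h1 : gorensteinDim R M < ((k - 1 : ℕ) : ℕ∞) := not_le.mp hlt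
      have h2 : ((k - 1 : ℕ) : ℕ∞) = ((k - 2 : ℕ) : ℕ∞) + 1 := by
        exact_mod_cast (by omega : k - 1 = k - 2 + 1)
      rw [h2] at h1
      exact (ENat.lt_add_one_iff (ENat.natCast_ne_top _)).mp h1
    obtain ⟨ε⟩ := nonempty_linearEquiv_of_isCanonicalModule hinj hn hdim hω
    obtain ⟨φ, hφ, hφI⟩ : ∃ φ ∈ s.rangeLambda ω, φ ∉ (I • ⊤ : Submodule R (F →ₗ[R] ω)) := by
      by_contra! h
      exact hα (lTensor_mkQ_injective h)
    obtain ⟨x, hx⟩ := exists_notMem_of_notMem_smul_top ε hφI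
    obtain ⟨f, g, hfg⟩ := exists_factorization_of_mem_rangeLambda s ε hφ x
    -- the value `ε (φ x)` annihilates `Ext^{k-1}(I, R)`, which is `Ext^k(R / I, R)`
    obtain ⟨j, rfl⟩ := Nat.exists_eq_succ_of_ne_zero (n := k) (by omega)
    have hkill : KillsExt (ε (φ x)) (R ⧸ I) R (j + 1) :=
      KillsExt.right (f := I.subtype) Subtype.val_injective (LinearMap.exact_subtype_mkQ I)
        I.mkQ_surjective (ExtVanishes.killsExt_of_factors hfg (hM j (by omega)))
        (.of_projective (by omega))
    have hzero := smul_eq_zero_of_killsExt hinj hn hek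
      ((Module.supportDim_quotient_eq_ringKrullDim I).trans he).le hRIext hkill
      (Ideal.Quotient.mk I 1)
    apply hx
    rwa [Algebra.smul_def, Ideal.Quotient.algebraMap_eq, map_one, mul_one,
      Ideal.Quotient.eq_zero_iff_mem] at hzero
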